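/- Let $\Sigma$ be a real analytic, connected, Hausdorff, paracompact $d$-dimensional manifold (orientable or not), and let $G$ be a compact connected (finite-dimensional) Lie group. **Curves.** Let $\mathcal C$ be the set of continuous maps $c:[0,1]\to\Sigma$ for which there are finitely many break points such that, on each closed subinterval $[a,b]\subset[0,1]$ $(a<b)$ with no break point in $]a,b[$, either $c$ is constant, or $c$ is real analytic on $[a,b]$ (one-sidedly at the end points) and restricts to an immersion of $]a,b[$ that is a homeomorphism onto its image. Write $s(c)=c(0)$, $r(c)=c(1)$, $c^{-1}(t)=c(1-t)$. If $s(c')=r(c)$, then $c'c$ denotes $c$ followed by $c'$, each at double speed. A reparametrization is an increasing homeomorphism $\varphi$ of $[0,1]$ which is analytic with nonvanishing derivative off a finite set. A retracing is a curve $\gamma^{-1}\gamma$ with $\gamma\in\mathcal C$. **The groupoid of paths.** Two curves with the same source and the same range are equivalent if one is obtained from the other by finitely many reparametrizations and insertions or deletions of retracings. More precisely, this is the least equivalence relation on curves with common end points which is compatible with composition and for which $c\sim c\circ\varphi$ whenever $\varphi$ is a reparametrization and $c,c\circ\varphi\in\mathcal C$, and for which $c\,(\gamma^{-1}\gamma)\sim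 c$ and $(\gamma^{-1}\gamma)\,c\sim c$ whenever defined. The equivalence classes (paths) are the arrows of a groupoid $\mathcal P$ with set of objects $\Sigma$: composition and inverse are induced from curves, and the identity at $x$ is the class of the constant curve at $x$ (equivalently, of any $\gamma^{-1}\gamma$ with $s(\gamma)=x$). **Tame subgroupoids.** An edge is a path $e$ represented by a curve $c$ which is analytic on all of $[0,1]$ and restricts to an immersion of $]0,1[$ that is a homeomorphism onto its image; put $\sigma(e)=c([0,1])$. A finite set of edges is independent if any two distinct edges $e,e'$ in it satisfy $\sigma(e)\cap\sigma(e')\subset\{s(e),r(e)\}\cap\{s(e'),r(e')\}$. A subgroupoid of $\mathcal P$ is tame if it is the smallest subgroupoid containing some independent finite set of edges. Let $\mathcal L$ be the set of tame subgroupoids, partially ordered by inclusion. **The projective limit.** Let $\mathrm{Hom}[\mathcal P,G]$ be the set of functors from $\mathcal P$ to $G$, i.e. of maps $\bar A:\mathcal P\to G$ with $\bar A(p'p)=\bar A(p')\bar A(p)$ and $\bar A(p^{-1})=\bar A(p)^{-1}$, and, for $L\in\mathcal L$, let $\mathcal A_L=\mathrm{Hom}[L,G]$ be the set of functors from $L$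 to $G$. For $L\subset L'$ in $\mathcal L$ let $p_{L,L'}:\mathcal A_{L'}\to\mathcal A_L$ be restriction to $L$, and let $$\mathcal A_\infty=\Bigl\{(A_L)_{L\in\mathcal L}\in\prod_{L\in\mathcal L}\mathcal A_L\ :\ p_{L,L'}A_{L'}=A_L\ \text{ for all } L\subset L' \text{ in }\mathcal L\Bigr\}.$$ **Proposition.** The map $$\Phi:\mathrm{Hom}[\mathcal P,G]\to\mathcal A_\infty,\qquad \bar A\mapsto(\bar A_{|L})_{L\in\mathcal L},$$ is a bijection. -/

import Mathlib

open scoped Manifold ContDiff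
open CategoryTheory

noncomputable section

/-! ### Piecewise analytic curves -/

section Curves

variable (d : ℕ) {M : Type*} [TopologicalSpace M] [ChartedSpace (EuclideanSpace ℝ (Fin d)) M]

/-- `γ` is an analytic arc on `[a, b]`: it is real analytic on the closed interval (one-sidedly at
the end points), and it restricts to an analytic embedding (an immersion which is a homeomorphism
onto its image) of the open interval `]a, b[`, whose image is thus an embedded submanifold. -/
structure IsAnalyticArc (γ : ℝ → M) (a b : ℝ) : Prop where
  analytic : ContMDiffOn 𝓘(ℝ, ℝ) (𝓡 d) ω γ (Set.Icc a b)
  immersion : ∀ t ∈ Set.Ioo a b, mfderiv 𝓘(ℝ, ℝ) (𝓡 d) γ t ≠ 0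
  embedding : Topology.IsEmbedding ((Set.Ioo a b).domRestrict γ)

/-- `γ : [0, 1] → M` is piecewise analytic: there are finitely many break points such that, on each
closed subinterval of `[0, 1]` without break points in its interior, `γ` is an analytic arc, or is
constant (its image is then an embedded submanifold of dimension zero). -/
def IsPiecewiseAnalytic {x y : M} (γ : Path x y) : Prop :=
  ∃ S : Finset ℝ, ∀ a b : ℝ, 0 ≤ a → a < b → b ≤ 1 → (∀ s ∈ S, s ∉ Set.Ioo a b) →
    IsAnalyticArc d γ.extend a b ∨ ∀ t ∈ Set.Icc a b, γ.extend t = γ.extend a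

/-- An affine change of parameter turns analytic arcs into analytic arcs. -/
theorem IsAnalyticArc.comp_affine {γ δ : ℝ → M} {a b a' b' k m : ℝ} (hγ : IsAnalyticArc d γ a' b')
    (hk : k ≠ 0) (hIcc : ∀ t ∈ Set.Icc a b, k * t + m ∈ Set.Icc a' b')
    (hIoo : ∀ t ∈ Set.Ioo a b, k * t + m ∈ Set.Ioo a' b')
    (h : ∀ t ∈ Set.Icc a b, δ t = γ (k * t + m)) : IsAnalyticArc d δ a b := by
  have haff : ContMDiff 𝓘(ℝ, ℝ) 𝓘(ℝ, ℝ) ω (fun t : ℝ => k * t + m) := by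
    rw [contMDiff_iff_contDiff]; fun_prop
  refine ⟨?_, ?_, ?_⟩
  · exact (hγ.analytic.comp haff.contMDiffOn hIcc).congr h
  · intro t ht hzero
    have hev : δ =ᶠ[nhds t] γ ∘ (fun t : ℝ => k * t + m) := by
      filter_upwards [isOpen_Ioo.mem_nhds ht] with s hs
      exact h s (Set.Ioo_subset_Icc_self hs)
    have hd : MDifferentiableAt 𝓘(ℝ, ℝ) (𝓡 d) γ (k * t + m) :=
      ((hγ.analytic.mono Set.Ioo_subset_Icc_self).contMDiffAt
        (isOpen_Ioo.mem_nhds (hIoo t ht))).mdifferentiableAt (by simp)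
    have hda : HasDerivAt (fun t : ℝ => k * t + m) k t := by
      simpa using ((hasDerivAt_id t).const_mul k).add_const m
    have hm := mfderiv_comp t hd (haff.mdifferentiable (by simp) t)
    rw [hev.mfderiv_eq, hm] at hzero
    refine hγ.immersion _ (hIoo t ht) ?_
    refine ContinuousLinearMap.ext fun (v : ℝ) => ?_
    have hv := DFunLike.congr_fun hzero (k⁻¹ * v : ℝ)
    have hw : mfderiv 𝓘(ℝ, ℝ) 𝓘(ℝ, ℝ) (fun t : ℝ => k * t + m) t (k⁻¹ * v : ℝ) = v := by
      rw [mfderiv_eq_fderiv]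
      have := hda.hasFDerivAt.fderiv
      rw [this]
      change (k⁻¹ * v) * k = v
      field_simp
    have hv' : mfderiv 𝓘(ℝ, ℝ) (𝓡 d) γ (k * t + m)
        (mfderiv 𝓘(ℝ, ℝ) 𝓘(ℝ, ℝ) (fun t : ℝ => k * t + m) t (k⁻¹ * v : ℝ)) = 0 := hv
    rw [hw] at hv'
    exact hv'
  · let e : ℝ ≃ₜ ℝ := (Homeomorph.mulLeft₀ k hk).trans (Homeomorph.addRight m)
    have he : Topology.IsEmbedding
        (fun t : Set.Ioo a b => (⟨k * t + m, hIoo t t.2⟩ : Set.Ioo a' b')) :=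
      (e.isEmbedding.comp Topology.IsEmbedding.subtypeVal).codRestrict _ (fun t => hIoo t t.2)
    have := hγ.embedding.comp he
    convert this using 1
    ext t
    exact h t (Set.Ioo_subset_Icc_self t.2)

theorem isPiecewiseAnalytic_refl (x : M) : IsPiecewiseAnalytic d (Path.refl x) :=
  ⟨∅, fun a b _ _ _ _ => Or.inr fun t _ => by simp⟩

theorem IsPiecewiseAnalytic.symm {x y : M} {γ : Path x y} (hγ : IsPiecewiseAnalytic d γ) :
    IsPiecewiseAnalytic d γ.symm := by
  obtain ⟨S, hS⟩ := hγ
  refine ⟨S.image (fun s => 1 - s), fun a b ha hab hb hs => ?_⟩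
  rcases hS (1 - b) (1 - a) (by linarith) (by linarith) (by linarith) (fun s hsS hsI =>
    hs (1 - s) (Finset.mem_image_of_mem _ hsS) ⟨by linarith [hsI.2], by linarith [hsI.1]⟩) with h | h
  · refine Or.inl (h.comp_affine d (k := -1) (m := 1) (by norm_num) ?_ ?_ ?_)
    · intro t ht; exact ⟨by linarith [ht.2], by linarith [ht.1]⟩
    · intro t ht; exact ⟨by linarith [ht.2], by linarith [ht.1]⟩
    · intro t _
      rw [Path.extend_symm_apply]
      congr 1; ring
  · refine Or.inr fun t ht => ?_
    rw [Path.extend_symm_apply, Path.extend_symm_apply,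
      h (1 - t) ⟨by linarith [ht.2], by linarith [ht.1]⟩,
      h (1 - a) ⟨by linarith, le_refl _⟩]

theorem IsPiecewiseAnalytic.trans {x y z : M} {γ : Path x y} {δ : Path y z}
    (hγ : IsPiecewiseAnalytic d γ) (hδ : IsPiecewiseAnalytic d δ) :
    IsPiecewiseAnalytic d (γ.trans δ) := by
  obtain ⟨S, hS⟩ := hγ
  obtain ⟨T, hT⟩ := hδ
  refine ⟨insert (1 / 2) (S.image (fun s => s / 2) ∪ T.image (fun s => (s + 1) / 2)),
    fun a b ha hab hb hs => ?_⟩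
  have hhalf : b ≤ 1 / 2 ∨ 1 / 2 ≤ a := by
    by_contra! hcon
    exact hs (1 / 2) (by simp) ⟨hcon.2, hcon.1⟩
  rcases hhalf with hle | hle
  · have hext : ∀ t ∈ Set.Icc a b, (γ.trans δ).extend t = γ.extend (2 * t + 0) := fun t ht => by
      rw [Path.extend_trans_of_le_half _ _ (ht.2.trans hle), add_zero]
    rcases hS (2 * a) (2 * b) (by linarith) (by linarith) (by linarith) (fun s hsS hsI =>
      hs (s / 2) (Finset.mem_insert_of_mem (Finset.mem_union_left _ (Finset.mem_image_of_mem _ hsS)))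
        ⟨by linarith [hsI.1], by linarith [hsI.2]⟩) with h | h
    · refine Or.inl (h.comp_affine d (k := 2) (m := 0) (by norm_num) ?_ ?_ hext)
      · intro t ht; exact ⟨by linarith [ht.1], by linarith [ht.2]⟩
      · intro t ht; exact ⟨by linarith [ht.1], by linarith [ht.2]⟩
    · refine Or.inr fun t ht => ?_
      rw [hext t ht, hext a ⟨le_refl _, hab.le⟩,
        h (2 * t + 0) ⟨by linarith [ht.1], by linarith [ht.2]⟩, add_zero]
  · have hext : ∀ t ∈ Set.Icc a b, (γ.trans δ).extend t = δ.extend (2 * t + (-1)) := fun t ht => by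
      rw [Path.extend_trans_of_half_le _ _ (hle.trans ht.1), sub_eq_add_neg]
    rcases hT (2 * a - 1) (2 * b - 1) (by linarith) (by linarith) (by linarith) (fun s hsS hsI =>
      hs ((s + 1) / 2)
        (Finset.mem_insert_of_mem (Finset.mem_union_right _ (Finset.mem_image_of_mem _ hsS)))
        ⟨by linarith [hsI.1], by linarith [hsI.2]⟩) with h | h
    · refine Or.inl (h.comp_affine d (k := 2) (m := -1) (by norm_num) ?_ ?_ hext)
      · intro t ht; exact ⟨by linarith [ht.1], by linarith [ht.2]⟩
      · intro t ht; exact ⟨by linarith [ht.1], by linarith [ht.2]⟩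
    · refine Or.inr fun t ht => ?_
      rw [hext t ht, hext a ⟨le_refl _, hab.le⟩,
        h (2 * t + (-1)) ⟨by linarith [ht.1], by linarith [ht.2]⟩, sub_eq_add_neg]

/-- The piecewise analytic parametrized curves from `x` to `y`. -/
def Curve (x y : M) : Type _ := {γ : Path x y // IsPiecewiseAnalytic d γ}

namespace Curve

variable {d} {x y z w : M}

/-- The constant curve. -/
def refl (x : M) : Curve d x x := ⟨Path.refl x, isPiecewiseAnalytic_refl d x⟩

/-- The curve `t ↦ c (1 - t)`. -/
def symm (c : Curve d x y) : Curve d y x := ⟨c.1.symm, c.2.symm d⟩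

/-- First `c` on `[0, 1/2]`, then `c'` on `[1/2, 1]`, each at double speed. -/
def trans (c : Curve d x y) (c' : Curve d y z) : Curve d x z :=
  ⟨c.1.trans c'.1, c.2.trans d c'.2⟩

end Curve

/-- `φ` restricts to an orientation preserving piecewise analytic diffeomorphism of `[0, 1]`: an
increasing homeomorphism of `[0, 1]` which is, on the open intervals between finitely many break
points, analytic with nonvanishing derivative. -/
structure IsReparametrization (φ : ℝ → ℝ) : Prop where
  map_zero : φ 0 = 0
  map_one : φ 1 = 1
  strictMonoOn : StrictMonoOn φ (Set.Icc 0 1)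
  continuousOn : ContinuousOn φ (Set.Icc 0 1)
  piecewise : ∃ S : Finset ℝ, ∀ t ∈ Set.Ioo (0 : ℝ) 1, t ∉ S → AnalyticAt ℝ φ t ∧ deriv φ t ≠ 0

/-- Two curves (with common end points) are equivalent if one is obtained from the other by
finitely many reparametrizations and insertions or deletions of retracings: the least equivalence
relation which is compatible with composition and identifies a curve with its reparametrizations,
and with its compositions with retracings. -/
inductive CurveEquiv : ∀ {x y : M}, Curve d x y → Curve d x y → Prop
  | rfl {x y : M} (c : Curve d x y) : CurveEquiv c c
  | symm {x y : M} {c c' : Curve d x y} : CurveEquiv c c' → CurveEquiv c' c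
  | trans {x y : M} {c c' c'' : Curve d x y} :
      CurveEquiv c c' → CurveEquiv c' c'' → CurveEquiv c c''
  | comp {x y z : M} {c₁ c₁' : Curve d x y} {c₂ c₂' : Curve d y z} :
      CurveEquiv c₁ c₁' → CurveEquiv c₂ c₂' → CurveEquiv (c₁.trans c₂) (c₁'.trans c₂')
  | reparam {x y : M} (c c' : Curve d x y) (φ : ℝ → ℝ) (hφ : IsReparametrization φ)
      (h : ∀ t ∈ Set.Icc (0 : ℝ) 1, c'.1.extend t = c.1.extend (φ t)) : CurveEquiv c c'
  | retrace_source {x y z : M} (γ : Curve d x z) (c : Curve d x y) :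
      CurveEquiv ((γ.trans γ.symm).trans c) c
  | retrace_range {x y z : M} (c : Curve d x y) (γ : Curve d y z) :
      CurveEquiv (c.trans (γ.trans γ.symm)) c

namespace CurveEquiv

variable {d} {x y z w : M}

theorem refl_trans (c : Curve d x y) : CurveEquiv d ((Curve.refl x).trans c) c := by
  have h := retrace_source (Curve.refl (d := d) x) c
  have e : (Curve.refl (d := d) x).trans (Curve.refl x).symm = Curve.refl x :=
    Subtype.ext (by simp [Curve.trans, Curve.symm, Curve.refl])
  rwa [e] at h

theorem trans_refl (c : Curve d x y) : CurveEquiv d (c.trans (Curve.refl y)) c := by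
  have h := retrace_range c (Curve.refl (d := d) y)
  have e : (Curve.refl (d := d) y).trans (Curve.refl y).symm = Curve.refl y :=
    Subtype.ext (by simp [Curve.trans, Curve.symm, Curve.refl])
  rwa [e] at h

theorem trans_symm (c : Curve d x y) : CurveEquiv d (c.trans c.symm) (Curve.refl x) :=
  (trans_refl _).symm.trans (retrace_source c (Curve.refl x))

theorem symm_trans (c : Curve d x y) : CurveEquiv d (c.symm.trans c) (Curve.refl y) := by
  have h := trans_symm c.symm
  have e : c.symm.symm = c := Subtype.ext (by simp [Curve.symm])
  rwa [e] at h

theorem assoc (c₁ : Curve d x y) (c₂ : Curve d y z) (c₃ : Curve d z w) :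
    CurveEquiv d ((c₁.trans c₂).trans c₃) (c₁.trans (c₂.trans c₃)) := by
  refine (reparam (c₁.trans (c₂.trans c₃)) ((c₁.trans c₂).trans c₃)
    (fun t => if t ≤ 1 / 4 then 2 * t else if t ≤ 1 / 2 then t + 1 / 4 else 1 / 2 * (t + 1))
    ⟨by norm_num, by norm_num, ?_, ?_, {1 / 4, 1 / 2}, ?_⟩ ?_).symm
  · intro s _ t _ hst
    dsimp only
    split_ifs <;> linarith
  · refine Continuous.continuousOn ?_
    refine Continuous.if_le (by fun_prop)
      (Continuous.if_le (by fun_prop) (by fun_prop) (by fun_prop) (by fun_prop) ?_)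
      (by fun_prop) (by fun_prop) ?_
    · intro t ht; subst ht; norm_num
    · intro t ht; subst ht; norm_num
  · intro t _ htS
    simp only [Finset.mem_insert, Finset.mem_singleton, not_or] at htS
    have key : ∀ k m : ℝ, k ≠ 0 → (fun t : ℝ => if t ≤ 1 / 4 then 2 * t else
        if t ≤ 1 / 2 then t + 1 / 4 else 1 / 2 * (t + 1)) =ᶠ[nhds t] (fun t => k * t + m) →
        AnalyticAt ℝ (fun t : ℝ => if t ≤ 1 / 4 then 2 * t else
        if t ≤ 1 / 2 then t + 1 / 4 else 1 / 2 * (t + 1)) t ∧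
        deriv (fun t : ℝ => if t ≤ 1 / 4 then 2 * t else
        if t ≤ 1 / 2 then t + 1 / 4 else 1 / 2 * (t + 1)) t ≠ 0 := by
      intro k m hk hev
      have hda : HasDerivAt (fun t : ℝ => k * t + m) k t := by
        simpa using ((hasDerivAt_id t).const_mul k).add_const m
      refine ⟨AnalyticAt.congr (by fun_prop) hev.symm, ?_⟩
      rw [hev.deriv_eq, hda.deriv]
      exact hk
    rcases lt_or_gt_of_ne htS.1 with h | h
    · refine key 2 0 (by norm_num) ?_
      filter_upwards [Iio_mem_nhds h] with s hs
      have : s ≤ 1 / 4 := le_of_lt hs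
      simp only [if_pos this, add_zero]
    · rcases lt_or_gt_of_ne htS.2 with h' | h'
      · refine key 1 (1 / 4) (by norm_num) ?_
        filter_upwards [Ioi_mem_nhds h, Iio_mem_nhds h'] with s hs hs'
        have h1 : ¬ s ≤ 1 / 4 := not_le.2 hs
        have h2 : s ≤ 1 / 2 := le_of_lt hs'
        simp only [if_neg h1, if_pos h2, one_mul]
      · refine key (1 / 2) (1 / 2) (by norm_num) ?_
        filter_upwards [Ioi_mem_nhds h'] with s hs
        have hs' : (1 / 2 : ℝ) < s := hs
        have h1 : ¬ s ≤ 1 / 4 := by linarith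
        have h2 : ¬ s ≤ 1 / 2 := by linarith
        simp only [if_neg h1, if_neg h2]
        ring
  · intro t _
    dsimp only [Curve.trans]
    by_cases h1 : t ≤ 1 / 4
    · rw [if_pos h1, Path.extend_trans_of_le_half _ _ (by linarith),
        Path.extend_trans_of_le_half _ _ (by linarith),
        Path.extend_trans_of_le_half _ _ (by linarith)]
    · by_cases h2 : t ≤ 1 / 2
      · rw [if_neg h1, if_pos h2, Path.extend_trans_of_le_half _ _ (by linarith),
          Path.extend_trans_of_half_le _ _ (by linarith),
          Path.extend_trans_of_half_le _ _ (by linarith),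
          Path.extend_trans_of_le_half _ _ (by linarith)]
        congr 1; ring
      · rw [if_neg h1, if_neg h2, Path.extend_trans_of_half_le _ _ (by linarith),
          Path.extend_trans_of_half_le _ _ (by linarith),
          Path.extend_trans_of_half_le _ _ (by linarith)]
        congr 1; ring

theorem inv {c c' : Curve d x y} (h : CurveEquiv d c c') : CurveEquiv d c.symm c'.symm :=
  (trans_refl c.symm).symm.trans <|
    ((CurveEquiv.rfl c.symm).comp ((trans_symm c').symm.trans (h.symm.comp (.rfl _)))).trans <|
      (assoc c.symm c c'.symm).symm.trans <|
        ((symm_trans c).comp (.rfl _)).trans (refl_trans _)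

end CurveEquiv

/-- The equivalence of curves with given end points. -/
def curveSetoid (x y : M) : Setoid (Curve d x y) where
  r := CurveEquiv d
  iseqv := ⟨CurveEquiv.rfl, CurveEquiv.symm, CurveEquiv.trans⟩

end Curves

/-! ### The groupoid of paths -/

/-- The objects of the groupoid of paths of the `d`-dimensional manifold `M`: its points. -/
@[ext]
structure PathGroupoid (d : ℕ) (M : Type*) where
  pt : M

section Groupoid

variable {d : ℕ} {M : Type*} [TopologicalSpace M] [ChartedSpace (EuclideanSpace ℝ (Fin d)) M]

/-- The groupoid of paths: the arrows are the equivalence classes of piecewise analytic curves.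
(`p ≫ q` is first `p`, then `q`.) -/
instance : Groupoid (PathGroupoid d M) where
  Hom x y := Quotient (curveSetoid d x.pt y.pt)
  id x := Quotient.mk _ (Curve.refl x.pt)
  comp p q := Quotient.map₂ Curve.trans (fun _ _ h _ _ h' => CurveEquiv.comp h h') p q
  id_comp p := Quotient.inductionOn p fun c => Quotient.sound (CurveEquiv.refl_trans c)
  comp_id p := Quotient.inductionOn p fun c => Quotient.sound (CurveEquiv.trans_refl c)
  assoc p q r := Quotient.inductionOn₃ p q r fun c c' c'' =>
    Quotient.sound (CurveEquiv.assoc c c' c'')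
  inv p := Quotient.map Curve.symm (fun _ _ h => CurveEquiv.inv h) p
  inv_comp p := Quotient.inductionOn p fun c => Quotient.sound (CurveEquiv.symm_trans c)
  comp_inv p := Quotient.inductionOn p fun c => Quotient.sound (CurveEquiv.trans_symm c)

/-- The path represented by a curve. -/
def Curve.toHom {x y : M} (c : Curve d x y) :
    (⟨x⟩ : PathGroupoid d M) ⟶ (⟨y⟩ : PathGroupoid d M) :=
  Quotient.mk (curveSetoid d x y) c

variable (d M) in
/-- A representative of an edge: a curve in `M` which is an analytic arc on all of `[0, 1]`. -/
structure EdgeCurve where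
  src : M
  tgt : M
  path : Path src tgt
  isAnalyticArc : IsAnalyticArc d path.extend 0 1

namespace EdgeCurve

/-- The image `σ(e)` of an edge. -/
def image (e : EdgeCurve d M) : Set M := Set.range e.path

theorem isPiecewiseAnalytic (e : EdgeCurve d M) : IsPiecewiseAnalytic d e.path :=
  ⟨∅, fun a b ha hab hb _ => Or.inl <|
    e.isAnalyticArc.comp_affine d (k := 1) (m := 0) one_ne_zero
      (fun t ht => ⟨by linarith [ht.1], by linarith [ht.2]⟩)
      (fun t ht => ⟨by linarith [ht.1], by linarith [ht.2]⟩)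
      (fun t _ => by rw [one_mul, add_zero])⟩

/-- The edge (an arrow of the groupoid of paths) represented by an analytic curve. -/
def toHom (e : EdgeCurve d M) : (⟨e.src⟩ : PathGroupoid d M) ⟶ (⟨e.tgt⟩ : PathGroupoid d M) :=
  Curve.toHom ⟨e.path, e.isPiecewiseAnalytic⟩

end EdgeCurve

/-- A set of edges (given by representatives) is independent if it is finite and distinct edges
intersect only at end points. -/
def IndependentEdges (E : Set (EdgeCurve d M)) : Prop :=
  E.Finite ∧ ∀ e ∈ E, ∀ e' ∈ E, e ≠ e' → e.image ∩ e'.image ⊆ {e.src, e.tgt}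

/-- The arrows of the groupoid of paths which are edges in `E`. -/
inductive IsEdgeIn (E : Set (EdgeCurve d M)) : ∀ x y : PathGroupoid d M, (x ⟶ y) → Prop
  | mk (e : EdgeCurve d M) (he : e ∈ E) : IsEdgeIn E ⟨e.src⟩ ⟨e.tgt⟩ e.toHom

/-- The smallest subgroupoid of the groupoid of paths which contains the edges in `E`. -/
def generatedByEdges (E : Set (EdgeCurve d M)) : Subgroupoid (PathGroupoid d M) :=
  Subgroupoid.generated fun x y => {p | IsEdgeIn E x y p}

variable (d M) in
/-- The set of tame subgroupoids, ordered by inclusion. -/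
def TameSubgroupoid : Type _ :=
  {L : Subgroupoid (PathGroupoid d M) //
    ∃ E : Set (EdgeCurve d M), IndependentEdges E ∧ L = generatedByEdges E}

variable (d M) in
instance : PartialOrder (TameSubgroupoid d M) :=
  inferInstanceAs (PartialOrder {L : Subgroupoid (PathGroupoid d M) //
    ∃ E : Set (EdgeCurve d M), IndependentEdges E ∧ L = generatedByEdges E})

/-! ### Morphisms to a group and the projective limit -/

variable (d M) in
/-- The functors from the groupoid of paths to the group `G`, seen as a category with one object
(in which `g ≫ h = h * g`). -/
abbrev PathHom (G : Type*) [Group G] : Type _ := PathGroupoid d M ⥤ SingleObj G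

/-- The morphisms from the tame subgroupoid `L` to the group `G`. -/
abbrev TameHom (L : TameSubgroupoid d M) (G : Type*) [Group G] : Type _ := L.1.objs ⥤ SingleObj G

/-- The projection given by restriction to a smaller tame subgroupoid. -/
def TameHom.restrict {G : Type*} [Group G] {L L' : TameSubgroupoid d M} (h : L ≤ L')
    (A : TameHom L' G) : TameHom L G :=
  Subgroupoid.inclusion (show L.1 ≤ L'.1 from h) ⋙ A

variable (d M) in
/-- The projective limit: the families `(A L)`, indexed by all tame subgroupoids, which are
consistent under the projections. -/
def ProjectiveLimit (G : Type*) [Group G] : Type _ :=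
  {A : ∀ L : TameSubgroupoid d M, TameHom L G //
    ∀ (L L' : TameSubgroupoid d M) (h : L ≤ L'), TameHom.restrict h (A L') = A L}

variable (d M) in
/-- The map sending a morphism to the family of its restrictions to the tame subgroupoids. -/
def restrictionMap (G : Type*) [Group G] (A : PathHom d M G) : ProjectiveLimit d M G :=
  ⟨fun L => L.1.hom ⋙ A, fun _ _ _ => rfl⟩

end Groupoid

end

/-!
A single edge `e` is an independent set, so that it generates a tame subgroupoid `L(e)`. Every path
is a composition of edges and identities, hence a functor on the groupoid of paths is determined by
its restrictions to the `L(e)` (`PathHom.ext_of_edges`); this gives injectivity.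

For surjectivity, let `A` be a consistent family, and assign to the edge `e` the value of
`A_{L(e)}` at `e` (`ProjectiveLimit.edgeValue`). This only depends on the path represented by `e`,
is inverted when `e` is reversed, and is multiplicative when an arc is cut in two: the two parts
are independent, so they generate a tame subgroupoid, which contains the arc as well
(`IsAnalyticArc.independentEdges_split`, `ProjectiveLimit.edgeValue_split`). The independence of
the parts rests on the fact that the end points of an arc do not lie on the open arc
(`IsAnalyticArc.ne_of_endpoint`). Hence the ordered product of the values at the arcs of a curve
does not depend on the choice of break points. This is organized as a discrete parallel transport:
a function `g` with `g v = A(γ|[u, v]) g u` whenever no break point lies in `]u, v[`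
(`ProjectiveLimit.IsTransport`) exists, and `g 1 * (g 0)⁻¹` does not depend on its choice
(`ProjectiveLimit.holonomy`). It is compatible with composition and inversion, hence trivial on
retracings, and invariant under reparametrization. It therefore descends to a functor on the
groupoid of paths (`ProjectiveLimit.toPathHom`). On a tame subgroupoid `L` the functor agrees with
`A_L`, because it does so at the generating edges, by consistency
(`ProjectiveLimit.value_eq_toPathHom_map`).

The directedness of the set of tame subgroupoids is not needed, nor are the finiteness properties of
the intersections of analytic arcs from which it would follow.
-/

noncomputable section

/-! ### Induction on break points -/

/-- A relation on intervals which is stable under juxtaposition holds on `[a, b]` if it holds on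
the subintervals of `[a, b]` whose interior avoids a given finite set. -/
theorem interval_induction_of_finset {P : ℝ → ℝ → Prop}
    (htrans : ∀ a b c, a < b → b < c → P a b → P b c → P a c) (S : Finset ℝ) :
    ∀ a b : ℝ, a < b →
      (∀ u v, a ≤ u → u < v → v ≤ b → (∀ s ∈ S, s ∉ Set.Ioo u v) → P u v) → P a b := by
  induction S using Finset.induction_on with
  | empty => exact fun a b hab h => h a b le_rfl hab le_rfl (by simp)
  | insert s S _ ih =>
    intro a b hab h
    by_cases hs : s ∈ Set.Ioo a b
    · refine htrans a s b hs.1 hs.2 (ih a s hs.1 ?_) (ih s b hs.2 ?_)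
      · intro u v hu huv hv hS
        refine h u v hu huv (hv.trans hs.2.le) fun r hr => ?_
        rcases Finset.mem_insert.1 hr with rfl | hr
        · exact fun hI => absurd hI.2 (not_lt.2 hv)
        · exact hS r hr
      · intro u v hu huv hv hS
        refine h u v (hs.1.le.trans hu) huv hv fun r hr => ?_
        rcases Finset.mem_insert.1 hr with rfl | hr
        · exact fun hI => absurd hI.1 (not_lt.2 hu)
        · exact hS r hr
    · refine ih a b hab fun u v hu huv hv hS => h u v hu huv hv fun r hr => ?_
      rcases Finset.mem_insert.1 hr with rfl | hr
      · exact fun hI => hs ⟨hu.trans_lt hI.1, hI.2.trans_le hv⟩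
      · exact hS r hr

/-! ### Reparametrizations -/

namespace IsReparametrization

protected theorem id : IsReparametrization (fun t => t) :=
  ⟨rfl, rfl, fun _ _ _ _ h => h, continuousOn_id, ∅, fun t _ _ =>
    ⟨analyticAt_id, by simp⟩⟩

theorem mapsTo {φ : ℝ → ℝ} (hφ : IsReparametrization φ) {t : ℝ} (ht : t ∈ Set.Icc (0 : ℝ) 1) :
    φ t ∈ Set.Icc (0 : ℝ) 1 := by
  constructor
  · have := hφ.strictMonoOn.monotoneOn (Set.left_mem_Icc.2 zero_le_one) ht ht.1
    rwa [hφ.map_zero] at this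
  · have := hφ.strictMonoOn.monotoneOn ht (Set.right_mem_Icc.2 zero_le_one) ht.2
    rwa [hφ.map_one] at this

/-- The restriction of a reparametrization to `[u, v]`, rescaled to the unit interval. -/
theorem rescale {φ : ℝ → ℝ} (hφ : IsReparametrization φ) {u v : ℝ} (hu : 0 ≤ u) (huv : u < v)
    (hv : v ≤ 1) :
    IsReparametrization (fun t => (φ (u + (v - u) * t) - φ u) / (φ v - φ u)) := by
  have hvu : 0 < v - u := sub_pos.2 huv
  have hmaps : ∀ t ∈ Set.Icc (0 : ℝ) 1, u + (v - u) * t ∈ Set.Icc (0 : ℝ) 1 := fun t ht =>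
    ⟨by nlinarith [ht.1], by nlinarith [ht.2]⟩
  have hlt : 0 < φ v - φ u :=
    sub_pos.2 (hφ.strictMonoOn ⟨hu, huv.le.trans hv⟩ ⟨hu.trans huv.le, hv⟩ huv)
  obtain ⟨S, hS⟩ := hφ.piecewise
  refine ⟨by simp, ?_, ?_, ?_, S.image (fun s => (s - u) / (v - u)), ?_⟩
  · rw [mul_one, add_sub_cancel, div_self hlt.ne']
  · intro s hs t ht hst
    have := hφ.strictMonoOn (hmaps s hs) (hmaps t ht) (by gcongr)
    dsimp only
    gcongr
  · have : ContinuousOn (fun t => φ (u + (v - u) * t)) (Set.Icc 0 1) :=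
      hφ.continuousOn.comp (by fun_prop) hmaps
    exact (this.sub continuousOn_const).div_const _
  · intro t ht htS
    have hI : u + (v - u) * t ∈ Set.Ioo (0 : ℝ) 1 := ⟨by nlinarith [ht.1], by nlinarith [ht.2]⟩
    have hnot : u + (v - u) * t ∉ S := fun h => htS <| Finset.mem_image.2
      ⟨_, h, by field_simp; ring⟩
    obtain ⟨han, hd⟩ := hS _ hI hnot
    have hda : HasDerivAt (fun t : ℝ => u + (v - u) * t) (v - u) t := by
      simpa using ((hasDerivAt_id t).const_mul (v - u)).const_add u
    have hcomp : AnalyticAt ℝ (fun t => φ (u + (v - u) * t)) t :=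
      AnalyticAt.fun_comp (f := fun t => u + (v - u) * t) han (by fun_prop)
    refine ⟨(hcomp.fun_sub analyticAt_const).fun_div analyticAt_const hlt.ne', ?_⟩
    have := ((han.differentiableAt.hasDerivAt.comp t hda).sub_const (φ u)).div_const (φ v - φ u)
    rw [show (fun t => (φ (u + (v - u) * t) - φ u) / (φ v - φ u)) =
      fun t => ((φ ∘ fun t => u + (v - u) * t) t - φ u) / (φ v - φ u) from rfl, this.deriv]
    exact div_ne_zero (mul_ne_zero hd hvu.ne') hlt.ne'

/-- The reparametrization which maps `[0, 1/2]` to `[0, β]` and `[1/2, 1]` to `[β, 1]`, affinely. -/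
theorem broken_line {β : ℝ} (h0 : 0 < β) (h1 : β < 1) :
    IsReparametrization
      (fun t => if t ≤ 1 / 2 then β * (2 * t) else β + (1 - β) * (2 * t - 1)) := by
  refine ⟨by norm_num, by norm_num, ?_, ?_, {1 / 2}, ?_⟩
  · intro s _ t _ hst
    dsimp only
    split_ifs <;> nlinarith
  · refine Continuous.continuousOn (Continuous.if_le (by fun_prop) (by fun_prop) (by fun_prop)
      (by fun_prop) ?_)
    rintro t rfl
    ring
  · intro t _ htS
    rw [Finset.mem_singleton] at htS
    have key : ∀ k m : ℝ, k ≠ 0 → (fun t : ℝ => if t ≤ 1 / 2 then β * (2 * t) else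
        β + (1 - β) * (2 * t - 1)) =ᶠ[nhds t] (fun t => k * t + m) →
        AnalyticAt ℝ (fun t : ℝ => if t ≤ 1 / 2 then β * (2 * t) else
          β + (1 - β) * (2 * t - 1)) t ∧
        deriv (fun t : ℝ => if t ≤ 1 / 2 then β * (2 * t) else
          β + (1 - β) * (2 * t - 1)) t ≠ 0 := by
      intro k m hk hev
      have hda : HasDerivAt (fun t : ℝ => k * t + m) k t := by
        simpa using ((hasDerivAt_id t).const_mul k).add_const m
      refine ⟨AnalyticAt.congr (by fun_prop) hev.symm, ?_⟩
      rw [hev.deriv_eq, hda.deriv]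
      exact hk
    rcases lt_or_gt_of_ne htS with h | h
    · refine key (β * 2) 0 (by positivity) ?_
      filter_upwards [Iio_mem_nhds h] with s hs
      rw [if_pos (le_of_lt hs)]
      ring
    · refine key ((1 - β) * 2) (β - (1 - β)) (by have := sub_pos.2 h1; positivity) ?_
      filter_upwards [Ioi_mem_nhds h] with s hs
      rw [if_neg (not_le.2 hs)]
      ring

end IsReparametrization

/-! ### Restricting curves and arcs to subintervals -/

section Restriction

variable {d : ℕ} {M : Type*} [TopologicalSpace M] [ChartedSpace (EuclideanSpace ℝ (Fin d)) M]

theorem Path.extend_ofLine {x y : M} {f : ℝ → M} (hf : ContinuousOn f (Set.Icc 0 1)) (h0 : f 0 = x)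
    (h1 : f 1 = y) {t : ℝ} (ht : t ∈ Set.Icc (0 : ℝ) 1) :
    (Path.ofLine hf h0 h1).extend t = f t := by
  rw [Path.extend_apply _ ht]
  rfl

/-- The curve `t ↦ c (a + (b - a) t)` runs through the restriction of `c` to `[a, b]`. -/
theorem Curve.exists_restrict {x y x' y' : M} (c : Curve d x y) {a b : ℝ} (ha : 0 ≤ a) (hab : a < b)
    (hb : b ≤ 1) (hx : c.1.extend a = x') (hy : c.1.extend b = y') :
    ∃ c' : Curve d x' y', ∀ t ∈ Set.Icc (0 : ℝ) 1,
      c'.1.extend t = c.1.extend (a + (b - a) * t) := by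
  have hcont : ContinuousOn (fun t => c.1.extend (a + (b - a) * t)) (Set.Icc 0 1) := by fun_prop
  have hext := fun t => Path.extend_ofLine (t := t) hcont (x := x') (y := y') (by simpa using hx)
    (by simpa using hy)
  refine ⟨⟨Path.ofLine hcont (by simpa using hx) (by simpa using hy), ?_⟩, hext⟩
  obtain ⟨S, hS⟩ := c.2
  have hba : 0 < b - a := sub_pos.2 hab
  refine ⟨S.image (fun s => (s - a) / (b - a)), fun u v hu huv hv hs => ?_⟩
  rcases hS (a + (b - a) * u) (a + (b - a) * v) (by positivity) (by gcongr)
    (by nlinarith) (fun s hsS hsI => hs _ (Finset.mem_image_of_mem _ hsS)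
      ⟨by rw [lt_div_iff₀ hba]; linarith [hsI.1], by rw [div_lt_iff₀ hba]; linarith [hsI.2]⟩)
    with h | h
  · refine Or.inl (h.comp_affine d (k := b - a) (m := a) hba.ne' ?_ ?_ ?_)
    · intro t ht; exact ⟨by nlinarith [ht.1], by nlinarith [ht.2]⟩
    · intro t ht; exact ⟨by nlinarith [ht.1], by nlinarith [ht.2]⟩
    · intro t ht
      rw [hext t ⟨hu.trans ht.1, ht.2.trans hv⟩, add_comm]
  · refine Or.inr fun t ht => ?_
    rw [hext t ⟨hu.trans ht.1, ht.2.trans hv⟩, hext u ⟨hu, huv.le.trans hv⟩]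
    exact h _ ⟨by nlinarith [ht.1], by nlinarith [ht.2]⟩

/-- A curve is equivalent to the composition of its two parts on `[0, β]` and `[β, 1]`. -/
theorem CurveEquiv.of_split {x y z : M} {c : Curve d x z} {c₁ : Curve d x y} {c₂ : Curve d y z}
    {β : ℝ} (h0 : 0 < β) (h1 : β < 1)
    (hc₁ : ∀ t ∈ Set.Icc (0 : ℝ) 1, c₁.1.extend t = c.1.extend (β * t))
    (hc₂ : ∀ t ∈ Set.Icc (0 : ℝ) 1, c₂.1.extend t = c.1.extend (β + (1 - β) * t)) :
    CurveEquiv d c (c₁.trans c₂) := by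
  refine CurveEquiv.reparam _ _ _ (IsReparametrization.broken_line h0 h1) fun t ht => ?_
  dsimp only [Curve.trans]
  split_ifs with h
  · rw [Path.extend_trans_of_le_half _ _ h, hc₁ _ ⟨by linarith [ht.1], by linarith⟩]
  · push Not at h
    rw [Path.extend_trans_of_half_le _ _ h.le, hc₂ _ ⟨by linarith, by linarith [ht.2]⟩]

theorem Curve.toHom_eq_of_reparam {x y : M} {c c' : Curve d x y} (φ : ℝ → ℝ)
    (hφ : IsReparametrization φ)
    (h : ∀ t ∈ Set.Icc (0 : ℝ) 1, c'.1.extend t = c.1.extend (φ t)) : c.toHom = c'.toHom :=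
  Quotient.sound (CurveEquiv.reparam c c' φ hφ h)

variable (d) in
/-- `γ` is an analytic arc or constant on `[a, b]`. -/
def IsElementary (γ : ℝ → M) (a b : ℝ) : Prop :=
  IsAnalyticArc d γ a b ∨ ∀ t ∈ Set.Icc a b, γ t = γ a

namespace IsAnalyticArc

variable {γ δ : ℝ → M} {a b c u v a' b' : ℝ}

theorem mono (h : IsAnalyticArc d γ a b) (hau : a ≤ u) (hvb : v ≤ b) : IsAnalyticArc d γ u v :=
  h.comp_affine d (k := 1) (m := 0) one_ne_zero
    (fun t ht => ⟨by linarith [ht.1], by linarith [ht.2]⟩)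
    (fun t ht => ⟨by linarith [ht.1], by linarith [ht.2]⟩)
    (fun t _ => by rw [one_mul, add_zero])

/-- Being an arc only depends on the affine parametrization over the unit interval. -/
theorem congr_rescale (h : IsAnalyticArc d γ a b) (hab : a < b) (hab' : a' < b')
    (heq : ∀ t ∈ Set.Icc (0 : ℝ) 1, δ (a' + (b' - a') * t) = γ (a + (b - a) * t)) :
    IsAnalyticArc d δ a' b' := by
  have h1 : 0 < b - a := sub_pos.2 hab
  have h2 : 0 < b' - a' := sub_pos.2 hab'
  have hk : 0 < (b - a) / (b' - a') := by positivity
  have e1 : ∀ t, (b - a) / (b' - a') * t + (a - (b - a) / (b' - a') * a') =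
      a + (b - a) / (b' - a') * (t - a') := fun t => by ring
  have e2 : b = a + (b - a) / (b' - a') * (b' - a') := by field_simp; ring
  refine h.comp_affine d (k := (b - a) / (b' - a')) (m := a - (b - a) / (b' - a') * a') hk.ne'
    ?_ ?_ ?_
  · intro t ht
    rw [e1]
    refine ⟨by nlinarith [ht.1], ?_⟩
    conv_rhs => rw [e2]
    nlinarith [ht.2]
  · intro t ht
    rw [e1]
    refine ⟨by nlinarith [ht.1], ?_⟩
    conv_rhs => rw [e2]
    nlinarith [ht.2]
  · intro t ht
    have := heq ((t - a') / (b' - a')) ⟨div_nonneg (by linarith [ht.1]) h2.le,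
      (div_le_one h2).2 (by linarith [ht.2])⟩
    rw [e1]
    convert this using 2
    · field_simp; ring
    · ring

theorem injOn_Ioo (h : IsAnalyticArc d γ a b) : Set.InjOn γ (Set.Ioo a b) :=
  Set.injOn_iff_injective.2 h.embedding.injective

theorem not_constant (h : IsAnalyticArc d γ a b) (hab : a < b) :
    ¬ ∀ t ∈ Set.Icc a b, γ t = γ a := by
  intro hc
  have h1 : a + (b - a) / 3 ∈ Set.Ioo a b := ⟨by linarith, by linarith⟩
  have h2 : a + 2 * (b - a) / 3 ∈ Set.Ioo a b := ⟨by linarith, by linarith⟩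
  have := h.injOn_Ioo h1 h2 ((hc _ (Set.Ioo_subset_Icc_self h1)).trans
    (hc _ (Set.Ioo_subset_Icc_self h2)).symm)
  linarith

/-- An end point of an arc does not lie on the open arc: otherwise the open arc would come back
close to one of its points, and would not carry the topology of an interval. -/
theorem ne_of_endpoint [T2Space M] (h : IsAnalyticArc d γ a b) {r t : ℝ} (hr : r = a ∨ r = b)
    (ht : t ∈ Set.Ioo a b) : γ r ≠ γ t := by
  intro heq
  have hab : a < b := ht.1.trans ht.2
  have hrI : r ∈ Set.Icc a b := by
    rcases hr with rfl | rfl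
    exacts [Set.left_mem_Icc.2 hab.le, Set.right_mem_Icc.2 hab.le]
  have hrO : r ∉ Set.Ioo a b := by
    rcases hr with rfl | rfl
    exacts [Set.left_notMem_Ioo, Set.right_notMem_Ioo]
  have hcl : r ∈ closure (Set.Ioo a b) := by rwa [closure_Ioo hab.ne]
  let l : Filter (Set.Ioo a b) := Filter.comap Subtype.val (nhds r)
  have hl : l.NeBot := mem_closure_iff_comap_neBot.1 hcl
  have hlim : Filter.Tendsto ((Set.Ioo a b).domRestrict γ) l (nhds (γ r)) := by
    have h1 : Filter.Tendsto γ (nhdsWithin r (Set.Icc a b)) (nhds (γ r)) :=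
      h.analytic.continuousOn r hrI
    have h2 : Filter.Tendsto (Subtype.val : Set.Ioo a b → ℝ) l (nhdsWithin r (Set.Icc a b)) :=
      tendsto_nhdsWithin_iff.2 ⟨Filter.tendsto_comap,
        Filter.Eventually.of_forall fun s => Set.Ioo_subset_Icc_self s.2⟩
    exact h1.comp h2
  rw [heq] at hlim
  have hlim' : Filter.Tendsto (fun s : Set.Ioo a b => s) l (nhds ⟨t, ht⟩) :=
    (h.embedding.tendsto_nhds_iff).2 hlim
  have h3 : Filter.Tendsto (Subtype.val : Set.Ioo a b → ℝ) l (nhds t) :=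
    (continuous_subtype_val.tendsto _).comp hlim'
  exact hrO (tendsto_nhds_unique Filter.tendsto_comap h3 ▸ ht)

theorem continuousOn_rescale (h : IsAnalyticArc d γ a b) (hab : a < b) :
    ContinuousOn (fun t => γ (a + (b - a) * t)) (Set.Icc 0 1) :=
  h.analytic.continuousOn.comp (by fun_prop)
    fun t ht => ⟨by nlinarith [ht.1], by nlinarith [ht.2]⟩

/-- The edge that runs through an analytic arc on `[a, b]`. -/
def edge (h : IsAnalyticArc d γ a b) (hab : a < b) : EdgeCurve d M where
  src := γ a
  tgt := γ b
  path := Path.ofLine (h.continuousOn_rescale hab) (by simp) (by simp)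
  isAnalyticArc := h.congr_rescale hab one_pos fun t ht => by
    rw [sub_zero, zero_add, one_mul]
    exact Path.extend_ofLine (h.continuousOn_rescale hab) (by simp) (by simp) ht

theorem edge_extend (h : IsAnalyticArc d γ a b) (hab : a < b) {t : ℝ}
    (ht : t ∈ Set.Icc (0 : ℝ) 1) : (h.edge hab).path.extend t = γ (a + (b - a) * t) :=
  Path.extend_ofLine (h.continuousOn_rescale hab) _ _ ht

theorem exists_of_mem_image_edge (h : IsAnalyticArc d γ a b) (hab : a < b) {x : M}
    (hx : x ∈ (h.edge hab).image) : ∃ t ∈ Set.Icc a b, γ t = x := by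
  obtain ⟨t, rfl⟩ := hx
  exact ⟨a + (b - a) * t, ⟨by nlinarith [t.2.1], by nlinarith [t.2.2]⟩, rfl⟩

/-- The two parts of a subdivided arc are independent edges; this also holds for a closed arc. -/
theorem independentEdges_split [T2Space M] (h : IsAnalyticArc d γ a c) (hab : a < b) (hbc : b < c) :
    IndependentEdges {(h.mono le_rfl hbc.le).edge hab, (h.mono hab.le le_rfl).edge hbc} := by
  have key : ∀ s ∈ Set.Icc a b, ∀ t ∈ Set.Icc b c, γ s = γ t →
      (γ s = γ a ∨ γ s = γ b) ∧ (γ s = γ b ∨ γ s = γ c) := by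
    intro s hs t ht hst
    rcases hs.1.eq_or_lt with rfl | hs'
    · rcases ht.2.eq_or_lt with rfl | ht'
      · exact ⟨Or.inl rfl, Or.inr hst⟩
      · exact absurd hst (h.ne_of_endpoint (Or.inl rfl) ⟨hab.trans_le ht.1, ht'⟩)
    · rcases ht.2.eq_or_lt with rfl | ht'
      · exact absurd hst.symm (h.ne_of_endpoint (Or.inr rfl) ⟨hs', hs.2.trans_lt hbc⟩)
      · have : s = t := h.injOn_Ioo ⟨hs', hs.2.trans_lt hbc⟩ ⟨hab.trans_le ht.1, ht'⟩ hst
        have hsb : s = b := le_antisymm hs.2 (this ▸ ht.1)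
        exact ⟨Or.inr (congrArg γ hsb), Or.inl (congrArg γ hsb)⟩
  refine ⟨Set.toFinite _, ?_⟩
  rintro e (rfl | rfl) e' (rfl | rfl) hne x ⟨hx, hx'⟩
  · exact absurd rfl hne
  · obtain ⟨s, hs, rfl⟩ := exists_of_mem_image_edge _ _ hx
    obtain ⟨t, ht, hts⟩ := exists_of_mem_image_edge _ _ hx'
    exact (key s hs t ht hts.symm).1
  · obtain ⟨t, ht, rfl⟩ := exists_of_mem_image_edge _ _ hx
    obtain ⟨s, hs, hst⟩ := exists_of_mem_image_edge _ _ hx'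
    rw [← hst]
    exact (key s hs t ht hst).2
  · exact absurd rfl hne

/-- A subdivided arc is, in the groupoid of paths, the composition of its two parts. -/
theorem toHom_edge_split (h : IsAnalyticArc d γ a c) (hab : a < b) (hbc : b < c) :
    (h.edge (hab.trans hbc)).toHom =
      ((h.mono le_rfl hbc.le).edge hab).toHom ≫ ((h.mono hab.le le_rfl).edge hbc).toHom := by
  have hca : 0 < c - a := sub_pos.2 (hab.trans hbc)
  have h1 : (b - a) / (c - a) < 1 := (div_lt_one hca).2 (by linarith)
  have h0 : 0 < (b - a) / (c - a) := div_pos (sub_pos.2 hab) hca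
  refine Quotient.sound (CurveEquiv.of_split h0 h1 (fun t ht => ?_) (fun t ht => ?_))
  · refine (edge_extend (h.mono le_rfl hbc.le) hab ht).trans (Eq.trans (congrArg γ ?_)
      (edge_extend h _ ⟨by nlinarith [ht.1], by nlinarith [ht.1, ht.2]⟩).symm)
    field_simp
  · refine (edge_extend (h.mono hab.le le_rfl) hbc ht).trans (Eq.trans (congrArg γ ?_)
      (edge_extend h _ ⟨by nlinarith [ht.1], by nlinarith [ht.1, ht.2]⟩).symm)
    field_simp
    ring

end IsAnalyticArc

end Restriction

section Holonomy

variable {d : ℕ} {M : Type*} [TopologicalSpace M] [ChartedSpace (EuclideanSpace ℝ (Fin d)) M]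
  {G : Type*} [Group G]

/-! ### Subgroupoids generated by edges -/

theorem EdgeCurve.toHom_mem_generatedByEdges {E : Set (EdgeCurve d M)} {e : EdgeCurve d M}
    (he : e ∈ E) : e.toHom ∈ (generatedByEdges E).arrows ⟨e.src⟩ ⟨e.tgt⟩ :=
  Subgroupoid.subset_generated _ _ _ (IsEdgeIn.mk e he)

theorem generatedByEdges_le {E : Set (EdgeCurve d M)} {S : Subgroupoid (PathGroupoid d M)}
    (h : ∀ e ∈ E, e.toHom ∈ S.arrows ⟨e.src⟩ ⟨e.tgt⟩) : generatedByEdges E ≤ S := by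
  refine sInf_le fun x y p hp => ?_
  obtain ⟨e, he⟩ := hp
  exact h e he

/-- The piecewise analytic curve underlying an edge. -/
def EdgeCurve.curve (e : EdgeCurve d M) : Curve d e.src e.tgt := ⟨e.path, e.isPiecewiseAnalytic⟩

/-- The tame subgroupoid generated by a single edge. -/
def EdgeCurve.tame (e : EdgeCurve d M) : TameSubgroupoid d M :=
  ⟨generatedByEdges {e}, {e}, ⟨Set.finite_singleton e, by
    rintro e₁ rfl e₂ rfl hne
    exact absurd rfl hne⟩, rfl⟩

theorem EdgeCurve.toHom_mem_tame (e : EdgeCurve d M) :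
    e.toHom ∈ e.tame.1.arrows ⟨e.src⟩ ⟨e.tgt⟩ :=
  EdgeCurve.toHom_mem_generatedByEdges rfl

namespace ProjectiveLimit

variable (A : ProjectiveLimit d M G)

/-! ### The values of a consistent family -/

/-- The value of the `L`-component of the consistent family `A` at an arrow of `L`. -/
def value (L : TameSubgroupoid d M) {x y : PathGroupoid d M} {p : x ⟶ y}
    (hp : p ∈ L.1.arrows x y) : G :=
  (A.1 L).map (X := ⟨x, Subgroupoid.mem_objs_of_src _ hp⟩)
    (Y := ⟨y, Subgroupoid.mem_objs_of_tgt _ hp⟩) ⟨p, hp⟩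

theorem value_congr (L : TameSubgroupoid d M) {x y : PathGroupoid d M} {p q : x ⟶ y} (h : p = q)
    (hp : p ∈ L.1.arrows x y) (hq : q ∈ L.1.arrows x y) : A.value L hp = A.value L hq := by
  subst h
  rfl

theorem value_mul (L : TameSubgroupoid d M) {x y z : PathGroupoid d M} {p : x ⟶ y} {q : y ⟶ z}
    (hp : p ∈ L.1.arrows x y) (hq : q ∈ L.1.arrows y z) :
    A.value L (L.1.mul hp hq) = A.value L hq * A.value L hp :=
  (A.1 L).map_comp (X := ⟨x, Subgroupoid.mem_objs_of_src _ hp⟩)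
    (Y := ⟨y, Subgroupoid.mem_objs_of_tgt _ hp⟩) (Z := ⟨z, Subgroupoid.mem_objs_of_tgt _ hq⟩)
    ⟨p, hp⟩ ⟨q, hq⟩

theorem value_inv (L : TameSubgroupoid d M) {x y : PathGroupoid d M} {p : x ⟶ y}
    (hp : p ∈ L.1.arrows x y) : A.value L (L.1.inv hp) = (A.value L hp)⁻¹ := by
  rw [eq_inv_iff_mul_eq_one, ← A.value_mul L hp (L.1.inv hp)]
  have hid : 𝟙 x ∈ L.1.arrows x x := Subgroupoid.id_mem_of_src _ hp
  rw [A.value_congr L (Groupoid.comp_inv p) _ hid]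
  exact (A.1 L).map_id ⟨x, Subgroupoid.mem_objs_of_src _ hp⟩

theorem value_mono {L L' : TameSubgroupoid d M} (h : L ≤ L') {x y : PathGroupoid d M} {p : x ⟶ y}
    (hp : p ∈ L.1.arrows x y) (hp' : p ∈ L'.1.arrows x y) : A.value L hp = A.value L' hp' := by
  have hA := A.2 L L' h
  unfold value
  rw [← hA]
  rfl

/-- The value of a consistent family at an edge, computed in the subgroupoid that it generates. -/
def edgeValue (e : EdgeCurve d M) : G := A.value e.tame e.toHom_mem_tame

/-- By consistency, the value at an edge can be computed in any tame subgroupoid containing it. -/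
theorem edgeValue_eq (e : EdgeCurve d M) (L : TameSubgroupoid d M)
    (h : e.toHom ∈ L.1.arrows ⟨e.src⟩ ⟨e.tgt⟩) : A.edgeValue e = A.value L h :=
  A.value_mono (generatedByEdges_le (by rintro _ rfl; exact h)) _ _

theorem edgeValue_eq_of_reparam {e e' : EdgeCurve d M} (φ : ℝ → ℝ) (hφ : IsReparametrization φ)
    (h : ∀ t ∈ Set.Icc (0 : ℝ) 1, e'.path.extend t = e.path.extend (φ t)) :
    A.edgeValue e' = A.edgeValue e := by
  have hs := h 0 (by simp)
  have ht := h 1 (by simp)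
  rw [hφ.map_zero, Path.extend_zero, Path.extend_zero] at hs
  rw [hφ.map_one, Path.extend_one, Path.extend_one] at ht
  obtain ⟨x, y, γ, hγ⟩ := e
  obtain ⟨x', y', γ', hγ'⟩ := e'
  dsimp only at hs ht
  subst hs ht
  have key : EdgeCurve.toHom ⟨x', y', γ, hγ⟩ = EdgeCurve.toHom ⟨x', y', γ', hγ'⟩ :=
    Curve.toHom_eq_of_reparam φ hφ h
  have hmem : EdgeCurve.toHom ⟨x', y', γ', hγ'⟩ ∈
      (EdgeCurve.tame ⟨x', y', γ, hγ⟩).1.arrows ⟨x'⟩ ⟨y'⟩ :=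
    key ▸ EdgeCurve.toHom_mem_tame _
  rw [A.edgeValue_eq _ _ hmem]
  exact A.value_congr _ key.symm _ _

theorem edgeValue_eq_inv {e e' : EdgeCurve d M}
    (h : ∀ t ∈ Set.Icc (0 : ℝ) 1, e'.path.extend t = e.path.extend (1 - t)) :
    A.edgeValue e' = (A.edgeValue e)⁻¹ := by
  have hs := h 0 (by simp)
  have ht := h 1 (by simp)
  rw [sub_zero, Path.extend_zero, Path.extend_one] at hs
  rw [sub_self, Path.extend_zero, Path.extend_one] at ht
  obtain ⟨x, y, γ, hγ⟩ := e
  obtain ⟨y', x', γ', hγ'⟩ := e'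
  dsimp only at hs ht
  subst hs ht
  have key : Groupoid.inv (EdgeCurve.toHom ⟨x', y', γ, hγ⟩) =
      EdgeCurve.toHom ⟨y', x', γ', hγ'⟩ :=
    Quotient.sound (CurveEquiv.reparam _ _ _ IsReparametrization.id fun t ht =>
      (h t ht).trans (Path.extend_symm_apply γ t).symm)
  have hinv := (EdgeCurve.tame ⟨x', y', γ, hγ⟩).1.inv
    (EdgeCurve.toHom_mem_tame ⟨x', y', γ, hγ⟩)
  have hmem : EdgeCurve.toHom ⟨y', x', γ', hγ'⟩ ∈
      (EdgeCurve.tame ⟨x', y', γ, hγ⟩).1.arrows ⟨y'⟩ ⟨x'⟩ := key ▸ hinv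
  rw [A.edgeValue_eq _ _ hmem, A.value_congr _ key.symm hmem hinv, A.value_inv]
  rfl

/-- The values of a consistent family at edges are multiplicative under subdivision: an arc and its
two parts all lie in the tame subgroupoid generated by the parts. -/
theorem edgeValue_split [T2Space M] {γ : ℝ → M} {a b c : ℝ} (h : IsAnalyticArc d γ a c)
    (hab : a < b) (hbc : b < c) :
    A.edgeValue (h.edge (hab.trans hbc)) =
      A.edgeValue ((h.mono hab.le le_rfl).edge hbc) *
        A.edgeValue ((h.mono le_rfl hbc.le).edge hab) := by
  let e₁ := (h.mono le_rfl hbc.le).edge hab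
  let e₂ := (h.mono hab.le le_rfl).edge hbc
  let L : TameSubgroupoid d M :=
    ⟨generatedByEdges {e₁, e₂}, _, h.independentEdges_split hab hbc, rfl⟩
  have h1 : e₁.toHom ∈ L.1.arrows ⟨γ a⟩ ⟨γ b⟩ :=
    EdgeCurve.toHom_mem_generatedByEdges (E := {e₁, e₂}) (e := e₁) (Or.inl rfl)
  have h2 : e₂.toHom ∈ L.1.arrows ⟨γ b⟩ ⟨γ c⟩ :=
    EdgeCurve.toHom_mem_generatedByEdges (E := {e₁, e₂}) (e := e₂) (Or.inr rfl)
  have h12 := L.1.mul h1 h2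
  have key := h.toHom_edge_split hab hbc
  have h3 : (h.edge (hab.trans hbc)).toHom ∈ L.1.arrows ⟨γ a⟩ ⟨γ c⟩ := key ▸ h12
  rw [A.edgeValue_eq e₁ L h1, A.edgeValue_eq e₂ L h2, A.edgeValue_eq _ L h3]
  exact (A.value_congr L key h3 h12).trans (A.value_mul L h1 h2)

/-! ### Parallel transport along curves -/

open Classical in
/-- The value of a consistent family at the restriction of `γ` to `[a, b]`, if this is an arc; by
convention it is `1` otherwise, which is the right value when `γ` is constant on `[a, b]`. -/
def arcValue (γ : ℝ → M) (a b : ℝ) : G :=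
  if h : a < b ∧ IsAnalyticArc d γ a b then A.edgeValue (h.2.edge h.1) else 1

theorem arcValue_of_arc {γ : ℝ → M} {a b : ℝ} (hab : a < b) (h : IsAnalyticArc d γ a b) :
    A.arcValue γ a b = A.edgeValue (h.edge hab) :=
  dif_pos ⟨hab, h⟩

theorem arcValue_of_not_arc {γ : ℝ → M} {a b : ℝ} (h : ¬ IsAnalyticArc d γ a b) :
    A.arcValue γ a b = 1 :=
  dif_neg fun h' => h h'.2

theorem arcValue_self (γ : ℝ → M) (a : ℝ) : A.arcValue γ a a = 1 :=
  dif_neg fun h => lt_irrefl _ h.1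

theorem arcValue_congr_reparam {γ δ : ℝ → M} {a b a' b' : ℝ} (hab : a < b) (hab' : a' < b')
    (hγ : IsAnalyticArc d γ a b) (hδ : IsAnalyticArc d δ a' b') (φ : ℝ → ℝ)
    (hφ : IsReparametrization φ)
    (h : ∀ t ∈ Set.Icc (0 : ℝ) 1, δ (a' + (b' - a') * t) = γ (a + (b - a) * φ t)) :
    A.arcValue δ a' b' = A.arcValue γ a b := by
  rw [A.arcValue_of_arc hab hγ, A.arcValue_of_arc hab' hδ]
  refine A.edgeValue_eq_of_reparam φ hφ fun t ht => ?_
  rw [hδ.edge_extend hab' ht, hγ.edge_extend hab (hφ.mapsTo ht), h t ht]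

theorem arcValue_congr_rescale {γ δ : ℝ → M} {a b a' b' : ℝ} (hab : a < b) (hab' : a' < b')
    (h : ∀ t ∈ Set.Icc (0 : ℝ) 1, δ (a' + (b' - a') * t) = γ (a + (b - a) * t)) :
    A.arcValue δ a' b' = A.arcValue γ a b := by
  by_cases hγ : IsAnalyticArc d γ a b
  · exact A.arcValue_congr_reparam hab hab' hγ (hγ.congr_rescale hab hab' h) _
      IsReparametrization.id h
  · rw [A.arcValue_of_not_arc hγ, A.arcValue_of_not_arc fun hδ =>
      hγ (hδ.congr_rescale hab' hab fun t ht => (h t ht).symm)]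

theorem arcValue_eq_inv {γ δ : ℝ → M} {a b a' b' : ℝ} (hab : a < b) (hab' : a' < b')
    (h : ∀ t ∈ Set.Icc (0 : ℝ) 1, δ (a' + (b' - a') * t) = γ (a + (b - a) * (1 - t))) :
    A.arcValue δ a' b' = (A.arcValue γ a b)⁻¹ := by
  have hrev : ∀ {γ δ : ℝ → M} {a b a' b' : ℝ}, a < b → a' < b' →
      (∀ t ∈ Set.Icc (0 : ℝ) 1, δ (a' + (b' - a') * t) = γ (a + (b - a) * (1 - t))) →
      IsAnalyticArc d γ a b → IsAnalyticArc d δ a' b' := by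
    intro γ δ a b a' b' hab hab' h hγ
    have hsymm : IsAnalyticArc d (fun s => γ (-s)) (-b) (-a) :=
      hγ.comp_affine d (k := -1) (m := 0) (by norm_num)
        (fun t ht => ⟨by linarith [ht.2], by linarith [ht.1]⟩)
        (fun t ht => ⟨by linarith [ht.2], by linarith [ht.1]⟩)
        (fun t _ => congrArg γ (by ring))
    refine hsymm.congr_rescale (neg_lt_neg hab) hab' fun t ht => ?_
    rw [h t ht]
    exact congrArg γ (by ring)
  by_cases hγ : IsAnalyticArc d γ a b
  · have hδ := hrev hab hab' h hγ
    rw [A.arcValue_of_arc hab hγ, A.arcValue_of_arc hab' hδ]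
    refine A.edgeValue_eq_inv fun t ht => ?_
    rw [hδ.edge_extend hab' ht, hγ.edge_extend hab ⟨by linarith [ht.2], by linarith [ht.1]⟩, h t ht]
  · have hδ : ¬ IsAnalyticArc d δ a' b' := fun hδ => hγ <| hrev hab' hab (fun t ht => by
      rw [h (1 - t) ⟨by linarith [ht.2], by linarith [ht.1]⟩, sub_sub_cancel]) hδ
    rw [A.arcValue_of_not_arc hγ, A.arcValue_of_not_arc hδ, inv_one]

theorem arcValue_mul [T2Space M] {γ : ℝ → M} {a b c : ℝ} (h : IsElementary d γ a c)
    (hab : a ≤ b) (hbc : b < c) :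
    A.arcValue γ a c = A.arcValue γ b c * A.arcValue γ a b := by
  rcases hab.eq_or_lt with rfl | hab
  · rw [arcValue_self, mul_one]
  rcases h with h | h
  · rw [A.arcValue_of_arc (hab.trans hbc) h, A.arcValue_of_arc hab (h.mono le_rfl hbc.le),
      A.arcValue_of_arc hbc (h.mono hab.le le_rfl), A.edgeValue_split h hab hbc]
  · rw [A.arcValue_of_not_arc fun h' => h'.not_constant (hab.trans hbc) h,
      A.arcValue_of_not_arc fun h' => h'.not_constant hab fun t ht =>
        h t ⟨ht.1, ht.2.trans hbc.le⟩,
      A.arcValue_of_not_arc fun h' => h'.not_constant hbc fun t ht =>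
        (h t ⟨hab.le.trans ht.1, ht.2⟩).trans (h b ⟨hab.le, hbc.le⟩).symm, mul_one]

/-- `g` is a parallel transport of the consistent family `A` along `γ` on `[a, b]`: away from
finitely many break points, `g v = A(γ|[u, v]) g u`. No condition ties the break points to those of
`γ`, so that they may be added freely. -/
def IsTransport (γ : ℝ → M) (a b : ℝ) (g : ℝ → G) : Prop :=
  ∃ S : Finset ℝ, ∀ u v, a ≤ u → u < v → v ≤ b → (∀ s ∈ S, s ∉ Set.Ioo u v) →
    g v = A.arcValue γ u v * g u

theorem isTransport_of_elementary [T2Space M] {γ : ℝ → M} {a b : ℝ}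
    (h : ∀ u v, a ≤ u → u < v → v ≤ b → IsElementary d γ u v) :
    A.IsTransport γ a b (A.arcValue γ a) :=
  ⟨∅, fun _ v hu huv hv _ => A.arcValue_mul (h a v le_rfl (hu.trans_lt huv) hv) hu huv⟩

theorem exists_isTransport [T2Space M] {x y : M} (c : Curve d x y) :
    ∃ g, A.IsTransport c.1.extend 0 1 g := by
  obtain ⟨S, hS⟩ := c.2
  refine interval_induction_of_finset (P := fun a b => ∃ g, A.IsTransport c.1.extend a b g) ?_ S
    0 1 one_pos ?_
  · rintro a b c' hab hbc ⟨g, T, hg⟩ ⟨g', T', hg'⟩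
    refine ⟨fun t => if t ≤ b then g t else g' t * (g' b)⁻¹ * g b, insert b (T ∪ T'), ?_⟩
    intro u v hu huv hv hs
    have hT : ∀ s ∈ T, s ∉ Set.Ioo u v := fun s hs' => hs s (by simp [hs'])
    have hT' : ∀ s ∈ T', s ∉ Set.Ioo u v := fun s hs' => hs s (by simp [hs'])
    have hb : v ≤ b ∨ b ≤ u := by
      by_contra! hcon
      exact hs b (by simp) ⟨hcon.2, hcon.1⟩
    dsimp only
    rcases hb with hb | hb
    · rw [if_pos hb, if_pos (huv.le.trans hb), hg u v hu huv hb hT]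
    · rw [if_neg (not_le.2 (hb.trans_lt huv)), hg' u v hb huv hv hT']
      split_ifs with hub
      · rw [le_antisymm hub hb]; group
      · group
  · intro u v hu huv hv hs
    exact ⟨_, A.isTransport_of_elementary fun u' v' hu' huv' hv' =>
      hS u' v' (hu.trans hu') huv' (hv'.trans hv) fun s hsS hsI =>
        hs s hsS ⟨hu'.trans_lt hsI.1, hsI.2.trans_le hv'⟩⟩

/-- The element `g b (g a)⁻¹` is the same for all parallel transports `g`: compare two of them on a
common refinement of their break points. -/
theorem IsTransport.unique {A : ProjectiveLimit d M G} {γ : ℝ → M} {a b : ℝ} (hab : a < b)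
    {g g' : ℝ → G} (hg : A.IsTransport γ a b g) (hg' : A.IsTransport γ a b g') :
    g b * (g a)⁻¹ = g' b * (g' a)⁻¹ := by
  obtain ⟨S, hS⟩ := hg
  obtain ⟨S', hS'⟩ := hg'
  refine interval_induction_of_finset (P := fun a b => g b * (g a)⁻¹ = g' b * (g' a)⁻¹) ?_ (S ∪ S')
    a b hab ?_
  · intro a b c _ _ h1 h2
    calc g c * (g a)⁻¹ = (g c * (g b)⁻¹) * (g b * (g a)⁻¹) := by group
      _ = (g' c * (g' b)⁻¹) * (g' b * (g' a)⁻¹) := by rw [h1, h2]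
      _ = g' c * (g' a)⁻¹ := by group
  · intro u v hu huv hv hs
    rw [hS u v hu huv hv fun s h => hs s (Finset.mem_union_left _ h),
      hS' u v hu huv hv fun s h => hs s (Finset.mem_union_right _ h), mul_inv_cancel_right,
      mul_inv_cancel_right]

variable [T2Space M]

/-- The holonomy of a consistent family along a curve: the ordered product of its values at the arcs
of the curve. -/
def holonomy {x y : M} (c : Curve d x y) : G :=
  (A.exists_isTransport c).choose 1 * ((A.exists_isTransport c).choose 0)⁻¹

theorem holonomy_eq {x y : M} {c : Curve d x y} {g : ℝ → G}
    (hg : A.IsTransport c.1.extend 0 1 g) : A.holonomy c = g 1 * (g 0)⁻¹ :=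
  (A.exists_isTransport c).choose_spec.unique one_pos hg

theorem holonomy_refl (x : M) : A.holonomy (Curve.refl (d := d) x) = 1 := by
  rw [A.holonomy_eq (g := fun _ => 1) ⟨∅, fun u v _ huv _ _ => ?_⟩]
  · simp
  · rw [A.arcValue_of_not_arc fun h => h.not_constant huv fun t _ => by simp [Curve.refl], mul_one]

theorem holonomy_edge (e : EdgeCurve d M) : A.holonomy e.curve = A.edgeValue e := by
  rw [A.holonomy_eq (c := e.curve) (A.isTransport_of_elementary fun u v hu _ hv =>
    Or.inl (e.isAnalyticArc.mono hu hv)), arcValue_self, inv_one, mul_one]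
  refine (A.arcValue_of_arc one_pos e.isAnalyticArc).trans ?_
  refine A.edgeValue_eq_of_reparam _ IsReparametrization.id fun t ht => ?_
  rw [e.isAnalyticArc.edge_extend one_pos ht]
  simp

theorem holonomy_trans {x y z : M} (c : Curve d x y) (c' : Curve d y z) :
    A.holonomy (c.trans c') = A.holonomy c' * A.holonomy c := by
  obtain ⟨g, S, hS⟩ := A.exists_isTransport c
  obtain ⟨g', S', hS'⟩ := A.exists_isTransport c'
  rw [A.holonomy_eq ⟨S, hS⟩, A.holonomy_eq ⟨S', hS'⟩,
    A.holonomy_eq (g := fun t => if t ≤ 1 / 2 then g (2 * t) else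
      g' (2 * t - 1) * (g' 0)⁻¹ * g 1)
      ⟨insert (1 / 2) (S.image (fun s => s / 2) ∪ S'.image (fun s => (s + 1) / 2)), ?_⟩]
  · norm_num
    group
  intro u v hu huv hv hs
  have hhalf : v ≤ 1 / 2 ∨ 1 / 2 ≤ u := by
    by_contra! hcon
    exact hs (1 / 2) (by simp) ⟨hcon.2, hcon.1⟩
  dsimp only
  rcases hhalf with h | h
  · have hval : A.arcValue (c.trans c').1.extend u v = A.arcValue c.1.extend (2 * u) (2 * v) := by
      refine A.arcValue_congr_rescale (by linarith) huv fun t ht => ?_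
      refine (Path.extend_trans_of_le_half c.1 c'.1 (by nlinarith [ht.2])).trans ?_
      congr 1
      ring
    rw [if_pos h, if_pos (huv.le.trans h), hval]
    exact hS _ _ (by linarith) (by linarith) (by linarith) fun s hsS hsI => hs (s / 2)
      (Finset.mem_insert_of_mem (Finset.mem_union_left _ (Finset.mem_image_of_mem _ hsS)))
      ⟨by linarith [hsI.1], by linarith [hsI.2]⟩
  · have hval : A.arcValue (c.trans c').1.extend u v =
        A.arcValue c'.1.extend (2 * u - 1) (2 * v - 1) := by
      refine A.arcValue_congr_rescale (by linarith) huv fun t ht => ?_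
      refine (Path.extend_trans_of_half_le c.1 c'.1 (by nlinarith [ht.1])).trans ?_
      congr 1
      ring
    rw [if_neg (not_le.2 (h.trans_lt huv)), hval, hS' (2 * u - 1) (2 * v - 1) (by linarith)
      (by linarith) (by linarith) fun s hsS hsI => hs ((s + 1) / 2)
      (Finset.mem_insert_of_mem (Finset.mem_union_right _ (Finset.mem_image_of_mem _ hsS)))
      ⟨by linarith [hsI.1], by linarith [hsI.2]⟩]
    split_ifs with h'
    · obtain rfl : u = 1 / 2 := le_antisymm h' h
      norm_num
    · group

theorem holonomy_symm {x y : M} (c : Curve d x y) : A.holonomy c.symm = (A.holonomy c)⁻¹ := by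
  obtain ⟨g, S, hS⟩ := A.exists_isTransport c
  rw [A.holonomy_eq ⟨S, hS⟩, A.holonomy_eq (g := fun t => g (1 - t))
    ⟨S.image (fun s => 1 - s), fun u v hu huv hv hs => ?_⟩]
  · simp
  have hval : A.arcValue c.symm.1.extend u v = (A.arcValue c.1.extend (1 - v) (1 - u))⁻¹ := by
    refine A.arcValue_eq_inv (by linarith) huv fun t _ => ?_
    refine (Path.extend_symm_apply c.1 _).trans ?_
    congr 1
    ring
  rw [hval, eq_inv_mul_iff_mul_eq]
  exact (hS _ _ (by linarith) (by linarith) (by linarith) fun s hsS hsI =>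
    hs _ (Finset.mem_image_of_mem _ hsS) ⟨by linarith [hsI.2], by linarith [hsI.1]⟩).symm

/-- The holonomy is invariant under reparametrization. After refining the break points, a curve and
its reparametrization are cut into corresponding pieces, both constant or both arcs, and in the
latter case the two pieces define the same edge; no regularity of `φ` at its break points matters.
-/
theorem holonomy_reparam {x y : M} (c c' : Curve d x y) (φ : ℝ → ℝ) (hφ : IsReparametrization φ)
    (h : ∀ t ∈ Set.Icc (0 : ℝ) 1, c'.1.extend t = c.1.extend (φ t)) :
    A.holonomy c = A.holonomy c' := by
  obtain ⟨g, S, hS⟩ := A.exists_isTransport c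
  obtain ⟨T, hT⟩ := c.2
  obtain ⟨T', hT'⟩ := c'.2
  have hfin : {t | t ∈ Set.Icc (0 : ℝ) 1 ∧ φ t ∈ S ∪ T}.Finite :=
    Set.Finite.of_finite_image ((S ∪ T).finite_toSet.subset (by rintro _ ⟨t, ht, rfl⟩; exact ht.2))
      (hφ.strictMonoOn.injOn.mono fun t ht => ht.1)
  rw [A.holonomy_eq ⟨S, hS⟩, A.holonomy_eq (c := c') (g := fun t => g (φ t))
    ⟨T' ∪ hfin.toFinset, fun u v hu huv hv hs => ?_⟩]
  · rw [hφ.map_one, hφ.map_zero]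
  have huI : u ∈ Set.Icc (0 : ℝ) 1 := ⟨hu, huv.le.trans hv⟩
  have hvI : v ∈ Set.Icc (0 : ℝ) 1 := ⟨hu.trans huv.le, hv⟩
  have hφuv := hφ.strictMonoOn huI hvI huv
  -- By the intermediate value theorem, `φ` maps `[u, v]` onto `[φ u, φ v]`.
  have hsurj : ∀ s ∈ Set.Icc (φ u) (φ v), ∃ t ∈ Set.Icc u v, φ t = s := fun s hs' =>
    intermediate_value_Icc huv.le
      (hφ.continuousOn.mono (Set.Icc_subset_Icc hu hv)) hs'
  have hmem : ∀ s ∈ S ∪ T, s ∉ Set.Ioo (φ u) (φ v) := by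
    intro s hsS hsI
    obtain ⟨t, ht, rfl⟩ := hsurj s (Set.Ioo_subset_Icc_self hsI)
    have htI : t ∈ Set.Icc (0 : ℝ) 1 := ⟨hu.trans ht.1, ht.2.trans hv⟩
    refine hs t (Finset.mem_union_right _ (hfin.mem_toFinset.2 ⟨htI, hsS⟩))
      ⟨(hφ.strictMonoOn.lt_iff_lt huI htI).1 hsI.1, (hφ.strictMonoOn.lt_iff_lt htI hvI).1 hsI.2⟩
  have hval : A.arcValue c'.1.extend u v = A.arcValue c.1.extend (φ u) (φ v) := by
    have hconst : (∀ t ∈ Set.Icc u v, c'.1.extend t = c'.1.extend u) ↔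
        ∀ t ∈ Set.Icc (φ u) (φ v), c.1.extend t = c.1.extend (φ u) := by
      constructor
      · intro hc s hs'
        obtain ⟨t, ht, rfl⟩ := hsurj s hs'
        rw [← h t ⟨hu.trans ht.1, ht.2.trans hv⟩, ← h u huI, hc t ht]
      · intro hc t ht
        have htI : t ∈ Set.Icc (0 : ℝ) 1 := ⟨hu.trans ht.1, ht.2.trans hv⟩
        rw [h t htI, h u huI]
        exact hc _ ⟨hφ.strictMonoOn.monotoneOn huI htI ht.1,
          hφ.strictMonoOn.monotoneOn htI hvI ht.2⟩
    rcases hT (φ u) (φ v) (hφ.mapsTo huI).1 hφuv (hφ.mapsTo hvI).2 (fun s hsT =>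
      hmem s (Finset.mem_union_right _ hsT)) with hc | hc
    · rcases hT' u v hu huv hv (fun s hsT => hs s (Finset.mem_union_left _ hsT)) with hc' | hc'
      · refine A.arcValue_congr_reparam hφuv huv hc hc' _ (hφ.rescale hu huv hv) fun t ht => ?_
        rw [h _ ⟨by nlinarith [ht.1], by nlinarith [ht.2]⟩,
          mul_div_cancel₀ _ (sub_pos.2 hφuv).ne', add_sub_cancel]
      · exact absurd (hconst.1 hc') (hc.not_constant hφuv)
    · rw [A.arcValue_of_not_arc fun h' => h'.not_constant hφuv hc,
        A.arcValue_of_not_arc fun h' => h'.not_constant huv (hconst.2 hc)]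
  dsimp only
  rw [hval]
  exact hS _ _ (hφ.mapsTo huI).1 hφuv (hφ.mapsTo hvI).2 fun s hsS =>
    hmem s (Finset.mem_union_left _ hsS)

theorem holonomy_eq_of_curveEquiv {x y : M} {c c' : Curve d x y} (h : CurveEquiv d c c') :
    A.holonomy c = A.holonomy c' := by
  induction h with
  | rfl c => rfl
  | symm _ ih => exact ih.symm
  | trans _ _ ih ih' => exact ih.trans ih'
  | comp _ _ ih ih' => rw [holonomy_trans, holonomy_trans, ih, ih']
  | reparam c c' φ hφ h => exact A.holonomy_reparam c c' φ hφ h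
  | retrace_source γ c => simp [holonomy_trans, holonomy_symm]
  | retrace_range c γ => simp [holonomy_trans, holonomy_symm]

/-- The functor on the groupoid of paths given by the holonomies of a consistent family. -/
def toPathHom : PathHom d M G where
  obj _ := SingleObj.star G
  map {x y} p := Quotient.lift (s := curveSetoid d x.pt y.pt) A.holonomy
    (fun _ _ h => A.holonomy_eq_of_curveEquiv h) p
  map_id x := A.holonomy_refl x.pt
  map_comp p q := Quotient.inductionOn₂ p q fun c c' => A.holonomy_trans c c'

theorem toPathHom_map_edge (e : EdgeCurve d M) : A.toPathHom.map e.toHom = A.edgeValue e :=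
  A.holonomy_edge e

/-- The functor given by the holonomies agrees with the `L`-component on the arrows of `L`, since
it does so on the generating edges. -/
theorem value_eq_toPathHom_map (L : TameSubgroupoid d M) {x y : PathGroupoid d M} {p : x ⟶ y}
    (hp : p ∈ L.1.arrows x y) : A.value L hp = A.toPathHom.map p := by
  let S : Subgroupoid (PathGroupoid d M) :=
    { arrows := fun x y => {p | ∃ hp : p ∈ L.1.arrows x y, A.value L hp = A.toPathHom.map p}
      inv := by
        rintro x y p ⟨hp, h⟩
        refine ⟨L.1.inv hp, ?_⟩
        rw [A.value_inv L hp, h, Groupoid.inv_eq_inv, Functor.map_inv, SingleObj.inv_as_inv]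
      mul := by
        rintro x y z p ⟨hp, h⟩ q ⟨hq, h'⟩
        refine ⟨L.1.mul hp hq, ?_⟩
        rw [A.value_mul L hp hq, h, h', Functor.map_comp, SingleObj.comp_as_mul] }
  obtain ⟨E, hE, hL⟩ := L.2
  have hle : L.1 ≤ S := by
    rw [hL]
    refine generatedByEdges_le fun e he => ?_
    have hmem : e.toHom ∈ L.1.arrows ⟨e.src⟩ ⟨e.tgt⟩ := by
      rw [hL]
      exact EdgeCurve.toHom_mem_generatedByEdges he
    exact ⟨hmem, by rw [toPathHom_map_edge, A.edgeValue_eq e L hmem]⟩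
  exact (((Subgroupoid.le_iff _ _).1 hle) hp).2

theorem restrictionMap_toPathHom : restrictionMap d M G A.toPathHom = A := by
  refine Subtype.ext (funext fun L => CategoryTheory.Functor.ext (fun _ => rfl) fun x y p => ?_)
  simp only [eqToHom_refl, Category.comp_id, Category.id_comp]
  exact (A.value_eq_toPathHom_map L p.2).symm

end ProjectiveLimit

/-! ### Functors on the groupoid of paths -/

/-- Every path is a composition of finitely many edges and identities, whence a functor is
determined by its values at edges. -/
theorem PathHom.ext_of_edges {F F' : PathHom d M G}
    (h : ∀ e : EdgeCurve d M, (F.map e.toHom : G) = F'.map e.toHom) : F = F' := by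
  refine CategoryTheory.Functor.ext (fun _ => rfl) fun x y p => ?_
  simp only [eqToHom_refl, Category.comp_id, Category.id_comp]
  obtain ⟨c, rfl⟩ := Quotient.exists_rep p
  obtain ⟨S, hS⟩ := c.2
  have key := interval_induction_of_finset (P := fun a b => 0 ≤ a → b ≤ 1 →
    ∀ (x' y' : M) (c' : Curve d x' y'), (∀ t ∈ Set.Icc (0 : ℝ) 1,
      c'.1.extend t = c.1.extend (a + (b - a) * t)) →
      (F.map c'.toHom : G) = F'.map c'.toHom) ?_ S 0 1 one_pos ?_
  · exact key le_rfl le_rfl x.pt y.pt c fun t _ => by simp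
  · intro a b b' hab hbb h1 h2 ha hb' x' z' c' hc'
    have hb0 : 0 < b' - a := sub_pos.2 (hab.trans hbb)
    have hβ0 : 0 < (b - a) / (b' - a) := div_pos (sub_pos.2 hab) hb0
    have hβ1 : (b - a) / (b' - a) < 1 := (div_lt_one hb0).2 (by linarith)
    obtain ⟨c₁, hc₁⟩ := c'.exists_restrict le_rfl hβ0 hβ1.le c'.1.extend_zero rfl
    obtain ⟨c₂, hc₂⟩ := c'.exists_restrict hβ0.le hβ1 le_rfl rfl c'.1.extend_one
    have hsplit : c'.toHom = c₁.toHom ≫ c₂.toHom := Quotient.sound <|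
      CurveEquiv.of_split hβ0 hβ1 (fun t ht => by rw [hc₁ t ht]; simp) hc₂
    rw [hsplit, Functor.map_comp, Functor.map_comp]
    refine congrArg₂ (fun g g' : G => g' * g)
      (h1 ha (hbb.le.trans hb') _ _ c₁ fun t ht => ?_)
      (h2 (ha.trans hab.le) hb' _ _ c₂ fun t ht => ?_)
    · rw [hc₁ t ht, hc' _ ⟨by nlinarith [ht.1], by nlinarith [ht.1, ht.2]⟩]
      congr 1
      field_simp
      ring
    · rw [hc₂ t ht, hc' _ ⟨by nlinarith [ht.1], by nlinarith [ht.1, ht.2]⟩]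
      congr 1
      field_simp
      ring
  · intro a b ha hab hb hs ha' hb' x' y' c' hc'
    rcases hS a b ha hab hb hs with hc | hc
    · let e : EdgeCurve d M := ⟨x', y', c'.1, hc.congr_rescale hab one_pos fun t ht => by
        rw [sub_zero, zero_add, one_mul, hc' t ht]⟩
      exact h e
    · have hconst : ∀ t ∈ Set.Icc (0 : ℝ) 1, c'.1.extend t = c.1.extend a := fun t ht => by
        rw [hc' t ht]
        exact hc _ ⟨by nlinarith [ht.1], by nlinarith [ht.2]⟩
      obtain rfl : x' = c.1.extend a := by simpa using hconst 0 (by simp)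
      obtain rfl : y' = c.1.extend a := by simpa using hconst 1 (by simp)
      have hid : c'.toHom = 𝟙 _ := Curve.toHom_eq_of_reparam (c' := Curve.refl _) _
        IsReparametrization.id fun t ht => by rw [hconst t ht]; simp [Curve.refl]
      rw [hid]
      exact (CategoryTheory.Functor.map_id F _).trans (CategoryTheory.Functor.map_id F' _).symm

theorem restrictionMap_injective : Function.Injective (restrictionMap d M G) := by
  intro F F' h
  refine PathHom.ext_of_edges fun e => ?_
  have hv : ∀ F : PathHom d M G,
      (restrictionMap d M G F).value e.tame e.toHom_mem_tame = F.map e.toHom := fun _ => rfl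
  rw [← hv, ← hv, h]

end Holonomy

end

theorem proposition2p1
    (d : ℕ) (M : Type*) [TopologicalSpace M] [ChartedSpace (EuclideanSpace ℝ (Fin d)) M]
    [IsManifold (𝓡 d) ω M] [T2Space M] [ParacompactSpace M] [ConnectedSpace M]
    (k : ℕ) (G : Type*) [TopologicalSpace G] [ChartedSpace (EuclideanSpace ℝ (Fin k)) G]
    [Group G] [LieGroup (𝓡 k) ∞ G] [CompactSpace G] [ConnectedSpace G] :
    Function.Bijective (restrictionMap d M G) :=
  ⟨restrictionMap_injective, fun A => ⟨A.toPathHom, A.restrictionMap_toPathHom⟩⟩
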